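/- Let $n\ge 3$ and consider the Gauss–Codazzi system of isothermic immersions in $\mathbb{E}^n$ for functions $\theta,\alpha_j,\beta_j$ ($j=3,\dots,n$) of $(u,v)$: $$\theta_{uu}+\theta_{vv}+\sum_{j=3}^n\alpha_j\beta_j=0,\qquad \alpha_{j,v}=\theta_v\beta_j,\qquad \beta_{j,u}=\theta_u\alpha_j\qquad(j=3,\dots,n).\tag{1}$$ Let $\xi,\eta,\Phi,A^j,B^j$ ($j=3,\dots,n$) be real functions of $(u,v,\theta,\alpha_3,\dots,\alpha_n,\beta_3,\dots,\beta_n)$ of class $C^2$ on a nonempty connected open set $\Omega\subseteq\mathbb{R}^{2n-1}$. With $D_u,D_v$ the total derivatives, put $$\Phi^u=D_u\Phi-(D_u\xi)\theta_u-(D_u\eta)\theta_v,\qquad \Phi^v=D_v\Phi-(D_v\xi)\theta_u-(D_v\eta)\theta_v,$$ $$A^{jv}=D_vA^j-\alpha_{j,u}D_v\xi-\alpha_{j,v}D_v\eta,\qquad B^{ju}=D_uB^j-\beta_{j,u}D_u\xi-\beta_{j,v}D_u\eta,$$ $$\Phi^{uu}=D_{uu}\Phi-(D_{uu}\xi)\theta_u-2(D_u\xi)\theta_{uu}-(D_{uu}\eta)\theta_v-2(D_u\eta)\theta_{uv},$$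 $$\Phi^{vv}=D_{vv}\Phi-(D_{vv}\xi)\theta_u-2(D_v\xi)\theta_{uv}-(D_{vv}\eta)\theta_v-2(D_v\eta)\theta_{vv}$$ (the coefficients of the prolongation of the vector field $\xi\partial_u+\eta\partial_v+\Phi\partial_\theta+\sum_jA^j\partial_{\alpha_j}+\sum_jB^j\partial_{\beta_j}$). Then the determining equations of Lie point symmetries of (1), $$\Phi^{uu}+\Phi^{vv}+\sum_k(A^k\beta_k+\alpha_kB^k)=0,\qquad A^{jv}=\Phi^v\beta_j+\theta_vB^j,\qquad B^{ju}=\Phi^u\alpha_j+\theta_uA^j\qquad(j=3,\dots,n),$$ hold at all second-order jets over $\Omega$ that satisfy (1) together with the first $u$- and $v$-derivatives of its first-order equations, if and only if there are real constants $c_0,c_1,c_2,c_3$ and a constant real matrix $(a^{jk})_{j,k=3}^n$ with $a^{jk}=-a^{kj}$ such that, on $\Omega$, $$\xi=c_0u+c_1,\qquad \eta=c_0v+c_2,\qquad \Phi=c_3,\qquad A^j=\sum_{k=3}^na^{jk}\alpha_k-c_0\alpha_j,\qquad B^j=\sum_{k=3}^na^{jk}\beta_k-c_0\beta_j\qquad(j=3,\dots,n).$$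 -/

import Mathlib

namespace Isothermic

/-- The normal indices `j = 3, …, n` of an immersion into `n`-dimensional Euclidean space. -/
abbrev NormalIndex (n : ℕ) : Type := ↥(Finset.Icc 3 n)

/-- The space of independent and dependent variables: `((u, v), θ, α, β)`, where
`α = (α_j)` and `β = (β_j)`. -/
abbrev Jet0 (n : ℕ) : Type :=
  (ℝ × ℝ) × ℝ × (NormalIndex n → ℝ) × (NormalIndex n → ℝ)

/-- The space of values of (a derivative of) the dependent variables `(θ, α, β)`. -/
abbrev Dep (n : ℕ) : Type := ℝ × (NormalIndex n → ℝ) × (NormalIndex n → ℝ)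

/-- The first jet space: a point of `Jet0 n`, then the `u`-derivatives of `(θ, α, β)`, then
their `v`-derivatives. -/
abbrev Jet1 (n : ℕ) : Type := Jet0 n × Dep n × Dep n

/-- A point of the second jet space: the independent variables, the dependent variables and all
their derivatives of order at most two, as independent coordinates. -/
structure Jet2 (n : ℕ) where
  u : ℝ
  v : ℝ
  θ : ℝ
  α : NormalIndex n → ℝ
  β : NormalIndex n → ℝ
  θ_u : ℝ
  α_u : NormalIndex n → ℝ
  β_u : NormalIndex n → ℝ
  θ_v : ℝ
  α_v : NormalIndex n → ℝ
  β_v : NormalIndex n → ℝ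
  θ_uu : ℝ
  α_uu : NormalIndex n → ℝ
  β_uu : NormalIndex n → ℝ
  θ_uv : ℝ
  α_uv : NormalIndex n → ℝ
  β_uv : NormalIndex n → ℝ
  θ_vv : ℝ
  α_vv : NormalIndex n → ℝ
  β_vv : NormalIndex n → ℝ

namespace Jet2

variable {n : ℕ}

/-- Projection of a second jet to the space of independent and dependent variables. -/
def jet0 (z : Jet2 n) : Jet0 n := ((z.u, z.v), z.θ, z.α, z.β)

/-- Projection of a second jet to the first jet space. -/
def jet1 (z : Jet2 n) : Jet1 n := (z.jet0, (z.θ_u, z.α_u, z.β_u), (z.θ_v, z.α_v, z.β_v))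

/-- The second jet satisfies the Gauss–Codazzi system
`θ_uu + θ_vv + ∑ α_j β_j = 0`, `α_{j,v} = θ_v β_j`, `β_{j,u} = θ_u α_j`. -/
def GaussCodazzi (z : Jet2 n) : Prop :=
  z.θ_uu + z.θ_vv + ∑ j, z.α j * z.β j = 0 ∧
  (∀ j, z.α_v j = z.θ_v * z.β j) ∧
  (∀ j, z.β_u j = z.θ_u * z.α j)

/-- The second jet satisfies the differential consequences of order two of the first order
equations: the `u`- and `v`-derivatives of `α_{j,v} = θ_v β_j` and of `β_{j,u} = θ_u α_j`. -/
def GaussCodazziConsequences (z : Jet2 n) : Prop :=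
  (∀ j, z.α_uv j = z.θ_uv * z.β j + z.θ_v * z.β_u j) ∧
  (∀ j, z.α_vv j = z.θ_vv * z.β j + z.θ_v * z.β_v j) ∧
  (∀ j, z.β_uu j = z.θ_uu * z.α j + z.θ_u * z.α_u j) ∧
  (∀ j, z.β_uv j = z.θ_uv * z.α j + z.θ_u * z.α_v j)

end Jet2

section TotalDerivatives

variable {n : ℕ}

/-- Total `u`-derivative of a function of the independent and dependent variables:
`F_u + θ_u F_θ + ∑ α_{k,u} F_{α_k} + ∑ β_{k,u} F_{β_k}`. -/
noncomputable def totalU0 (F : Jet0 n → ℝ) (w : Jet1 n) : ℝ :=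
  fderiv ℝ F w.1 ((1, 0), w.2.1)

/-- Total `v`-derivative of a function of the independent and dependent variables. -/
noncomputable def totalV0 (F : Jet0 n → ℝ) (w : Jet1 n) : ℝ :=
  fderiv ℝ F w.1 ((0, 1), w.2.2)

/-- Total `u`-derivative of a function on the first jet space. -/
noncomputable def totalU1 (G : Jet1 n → ℝ) (z : Jet2 n) : ℝ :=
  fderiv ℝ G z.jet1
    (((1, 0), (z.θ_u, z.α_u, z.β_u)), (z.θ_uu, z.α_uu, z.β_uu), (z.θ_uv, z.α_uv, z.β_uv))

/-- Total `v`-derivative of a function on the first jet space. -/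
noncomputable def totalV1 (G : Jet1 n → ℝ) (z : Jet2 n) : ℝ :=
  fderiv ℝ G z.jet1
    (((0, 1), (z.θ_v, z.α_v, z.β_v)), (z.θ_uv, z.α_uv, z.β_uv), (z.θ_vv, z.α_vv, z.β_vv))

/-- `D_u F` as a function of the second jet. -/
noncomputable def Du (F : Jet0 n → ℝ) (z : Jet2 n) : ℝ := totalU0 F z.jet1

/-- `D_v F` as a function of the second jet. -/
noncomputable def Dv (F : Jet0 n → ℝ) (z : Jet2 n) : ℝ := totalV0 F z.jet1

/-- `D_{uu} F = D_u (D_u F)`. -/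
noncomputable def Duu (F : Jet0 n → ℝ) (z : Jet2 n) : ℝ := totalU1 (totalU0 F) z

/-- `D_{vv} F = D_v (D_v F)`. -/
noncomputable def Dvv (F : Jet0 n → ℝ) (z : Jet2 n) : ℝ := totalV1 (totalV0 F) z

end TotalDerivatives

/-- Coefficients of the vector field
`ξ ∂_u + η ∂_v + Φ ∂_θ + ∑ A^j ∂_{α_j} + ∑ B^j ∂_{β_j}`, as functions of
`(u, v, θ, α, β)`. -/
structure PointVectorField (n : ℕ) where
  ξ : Jet0 n → ℝ
  η : Jet0 n → ℝ
  Φ : Jet0 n → ℝ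
  A : NormalIndex n → Jet0 n → ℝ
  B : NormalIndex n → Jet0 n → ℝ

namespace PointVectorField

variable {n : ℕ}

/-- All coefficients are twice continuously differentiable on `Ω`. -/
def IsC2On (X : PointVectorField n) (Ω : Set (Jet0 n)) : Prop :=
  ContDiffOn ℝ 2 X.ξ Ω ∧ ContDiffOn ℝ 2 X.η Ω ∧ ContDiffOn ℝ 2 X.Φ Ω ∧
  (∀ j, ContDiffOn ℝ 2 (X.A j) Ω) ∧ (∀ j, ContDiffOn ℝ 2 (X.B j) Ω)

/-- The coefficient of `∂_{θ_u}` in the prolongation. -/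
noncomputable def Φu (X : PointVectorField n) (z : Jet2 n) : ℝ :=
  Du X.Φ z - Du X.ξ z * z.θ_u - Du X.η z * z.θ_v

/-- The coefficient of `∂_{θ_v}` in the prolongation. -/
noncomputable def Φv (X : PointVectorField n) (z : Jet2 n) : ℝ :=
  Dv X.Φ z - Dv X.ξ z * z.θ_u - Dv X.η z * z.θ_v

/-- The coefficient of `∂_{α_{j,v}}` in the prolongation. -/
noncomputable def Av (X : PointVectorField n) (j : NormalIndex n) (z : Jet2 n) : ℝ :=
  Dv (X.A j) z - z.α_u j * Dv X.ξ z - z.α_v j * Dv X.η z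

/-- The coefficient of `∂_{β_{j,u}}` in the prolongation. -/
noncomputable def Bu (X : PointVectorField n) (j : NormalIndex n) (z : Jet2 n) : ℝ :=
  Du (X.B j) z - z.β_u j * Du X.ξ z - z.β_v j * Du X.η z

/-- The coefficient of `∂_{θ_uu}` in the prolongation. -/
noncomputable def Φuu (X : PointVectorField n) (z : Jet2 n) : ℝ :=
  Duu X.Φ z - Duu X.ξ z * z.θ_u - 2 * Du X.ξ z * z.θ_uu
    - Duu X.η z * z.θ_v - 2 * Du X.η z * z.θ_uv

/-- The coefficient of `∂_{θ_vv}` in the prolongation. -/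
noncomputable def Φvv (X : PointVectorField n) (z : Jet2 n) : ℝ :=
  Dvv X.Φ z - Dvv X.ξ z * z.θ_u - 2 * Dv X.ξ z * z.θ_uv
    - Dvv X.η z * z.θ_v - 2 * Dv X.η z * z.θ_vv

/-- The determining equations at a second jet: the prolonged vector field annihilates the three
groups of equations of the Gauss–Codazzi system there. -/
def DeterminingEquationsAt (X : PointVectorField n) (z : Jet2 n) : Prop :=
  X.Φuu z + X.Φvv z + ∑ k, X.A k z.jet0 * z.β k + ∑ k, z.α k * X.B k z.jet0 = 0 ∧
  (∀ j, X.Av j z = X.Φv z * z.β j + z.θ_v * X.B j z.jet0) ∧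
  (∀ j, X.Bu j z = X.Φu z * z.α j + z.θ_u * X.A j z.jet0)

/-- The determining equations of Lie point symmetries of the Gauss–Codazzi system over `Ω`: they
hold at all second jets over `Ω` that satisfy the system (and its differential consequences),
that is, as identities in the derivatives that the system leaves free. -/
def DeterminingEquationsOn (X : PointVectorField n) (Ω : Set (Jet0 n)) : Prop :=
  ∀ z : Jet2 n, z.jet0 ∈ Ω → z.GaussCodazzi → z.GaussCodazziConsequences →
    X.DeterminingEquationsAt z

end PointVectorField

end Isothermic

/-!
The solution jets of the Gauss–Codazzi system over a point are parametrised by the free derivatives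
`θ_u, θ_v, α_u, β_v, θ_uu, θ_uv, α_uu, β_vv` (`freeJet`; `θ_uv` is not needed), and the determining
equations are polynomial in them. Their coefficients give, in turn:

* `D_v ξ = 0` and `D_u η = 0`, from the coefficients of `α_{j,u}` and `β_{j,v}` in the Codazzi
  equations. So `ξ` does not depend on `v, β`, and `ξ_θ + ∑ β_k ξ_{α_k} = 0`; differentiating this
  along `β` gives `ξ = ξ(u)`, and likewise `η = η(v)` (`fderiv_ξ`, `fderiv_η`).
* `Φ_α = Φ_β = 0`, from the coefficients of `α_uu` and `β_vv` in the Gauss equation. The Codazzi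
  equations are then `A^j_β = 0`, `A^j_v = β_j Φ_v`,
  `A^j_θ + ∑ β_k A^j_{α_k} = β_j Φ_θ + B^j`, and the same with the roles of
  `(u, α, A)` and `(v, β, B)` exchanged (`fderiv_A`, `fderiv_B`). Differentiating along `β`:
  `Φ_v = 0` and `A^j_{α_k} = δ_{jk} Φ_θ + B^j_{β_k}`. Exchanging the roles, `Φ_u = 0` and
  `B^j_{β_k} = δ_{jk} Φ_θ + A^j_{α_k}`. Hence `Φ_θ = 0`, and `Φ` is constant.
* `ξ'' = 0`, `ξ' = η'` and `2 ξ' ∑ α_k β_k + ∑ (A^k β_k + α_k B^k) = 0`, from the rest of the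
  Gauss equation (`gauss_split`).

The common Jacobian `m^{jk} = A^j_{α_k} = B^j_{β_k}` is constant (`second_fderiv_A`). With
`c₀ = ξ'`, the derivative of the last relation along `β_k` is
`A^k = -∑ m^{lk} α_l - 2 c₀ α_k`, and along `α_k` it is the same formula for `B^k` and `β`.
Differentiating once more shows that `m + c₀` is antisymmetric (`exists_constants`). All these are
identities between first and second derivatives at single points of `Ω`; connectedness is used only
to pass from zero derivative to constant. The converse is a direct computation.
-/

namespace Isothermic

/-! ### First and second derivatives along vector fields -/

section SecondDerivatives

variable {E W : Type*} [NormedAddCommGroup E] [NormedSpace ℝ E]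
  [NormedAddCommGroup W] [NormedSpace ℝ W] {Ω : Set E} {F : E → ℝ} {x : E}

theorem hasFDerivAt_fderiv (hΩ : IsOpen Ω) (hF : ContDiffOn ℝ 2 F Ω) (hx : x ∈ Ω) :
    HasFDerivAt (fderiv ℝ F) (fderiv ℝ (fderiv ℝ F) x) x :=
  (((hF.contDiffAt (hΩ.mem_nhds hx)).fderiv_right (m := 1) (by norm_num)).differentiableAt
    (by norm_num)).hasFDerivAt

theorem hasFDerivAt_fderiv_apply (hΩ : IsOpen Ω) (hF : ContDiffOn ℝ 2 F Ω) (hx : x ∈ Ω)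
    (e : E) :
    HasFDerivAt (fun y => fderiv ℝ F y e) ((fderiv ℝ (fderiv ℝ F) x).flip e) x := by
  simpa using (hasFDerivAt_fderiv hΩ hF hx).clm_apply (hasFDerivAt_const e x)

theorem hasFDerivAt_of_contDiffOn (hΩ : IsOpen Ω) (hF : ContDiffOn ℝ 2 F Ω) (hx : x ∈ Ω) :
    HasFDerivAt F (fderiv ℝ F x) x :=
  ((hF.contDiffAt (hΩ.mem_nhds hx)).differentiableAt (by norm_num)).hasFDerivAt

theorem second_fderiv_comm (hΩ : IsOpen Ω) (hF : ContDiffOn ℝ 2 F Ω) (hx : x ∈ Ω) (a b : E) :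
    fderiv ℝ (fderiv ℝ F) x a b = fderiv ℝ (fderiv ℝ F) x b a :=
  (hF.contDiffAt (hΩ.mem_nhds hx)).isSymmSndFDerivAt (by simp) a b

/-- Differentiation of an identity `V F = G`, where `V` is a vector field on `Ω`. -/
theorem second_fderiv_of_fderiv_eq (hΩ : IsOpen Ω) (hF : ContDiffOn ℝ 2 F Ω) (hx : x ∈ Ω)
    {V : E → E} {V' : E →L[ℝ] E} {G : E → ℝ} {G' : E →L[ℝ] ℝ}
    (h : ∀ y ∈ Ω, fderiv ℝ F y (V y) = G y)
    (hV : HasFDerivAt V V' x) (hG : HasFDerivAt G G' x) (b : E) :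
    fderiv ℝ (fderiv ℝ F) x b (V x) + fderiv ℝ F x (V' b) = G' b := by
  have h1 := (hasFDerivAt_fderiv hΩ hF hx).clm_apply hV
  have h2 : HasFDerivAt (fun y => fderiv ℝ F y (V y)) G' x :=
    hG.congr_of_eventuallyEq (by filter_upwards [hΩ.mem_nhds hx] with y hy using h y hy)
  have := congrArg (fun L : E →L[ℝ] ℝ => L b) (h1.unique h2)
  simpa [add_comm] using this

theorem second_fderiv_eq_zero (hΩ : IsOpen Ω) (hF : ContDiffOn ℝ 2 F Ω) (hx : x ∈ Ω) {e : E}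
    (h : ∀ y ∈ Ω, fderiv ℝ F y e = 0) (b : E) : fderiv ℝ (fderiv ℝ F) x b e = 0 := by
  simpa using second_fderiv_of_fderiv_eq hΩ hF hx (V := fun _ => e) (G := fun _ => 0) h
    (hasFDerivAt_const e x) (hasFDerivAt_const 0 x) b

theorem second_fderiv_eq_zero' (hΩ : IsOpen Ω) (hF : ContDiffOn ℝ 2 F Ω) (hx : x ∈ Ω) {e : E}
    (h : ∀ y ∈ Ω, fderiv ℝ F y e = 0) (b : E) : fderiv ℝ (fderiv ℝ F) x e b = 0 := by
  rw [second_fderiv_comm hΩ hF hx, second_fderiv_eq_zero hΩ hF hx h]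

/-- If `F` does not vary in the directions `i w`, which move the coordinate `c` by `w`, then the
derivative along `i w` of the identity `(e + j c) F = G` is `(j w) F = (i w) G`. -/
theorem fderiv_eq_of_transport (hΩ : IsOpen Ω) (hF : ContDiffOn ℝ 2 F Ω) (hx : x ∈ Ω)
    {e : E} {i j : W →L[ℝ] E} {c : E →L[ℝ] W} (hc : ∀ w, c (i w) = w)
    (hi : ∀ y ∈ Ω, ∀ w, fderiv ℝ F y (i w) = 0) {G : E → ℝ} {G' : E →L[ℝ] ℝ}
    (h : ∀ y ∈ Ω, fderiv ℝ F y (e + j (c y)) = G y) (hG : HasFDerivAt G G' x) (w : W) :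
    fderiv ℝ F x (j w) = G' (i w) := by
  have hV : HasFDerivAt (fun y => e + j (c y)) (j.comp c) x :=
    (j.comp c).hasFDerivAt.const_add e
  have := second_fderiv_of_fderiv_eq hΩ hF hx h hV hG (i w)
  rw [second_fderiv_eq_zero' hΩ hF hx (fun y hy => hi y hy w)] at this
  simpa [hc] using this

/-- The Hessian of a function whose differential is a multiple of a fixed linear form `l`. -/
theorem second_fderiv_of_fderiv_eq_mul (hΩ : IsOpen Ω) (hF : ContDiffOn ℝ 2 F Ω) (hx : x ∈ Ω)
    {e : E} {l : E → ℝ} (h : ∀ y ∈ Ω, ∀ d, fderiv ℝ F y d = l d * fderiv ℝ F y e) (a b : E) :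
    fderiv ℝ (fderiv ℝ F) x a b = l a * l b * fderiv ℝ (fderiv ℝ F) x e e := by
  have key : ∀ a b, fderiv ℝ (fderiv ℝ F) x a b = l b * fderiv ℝ (fderiv ℝ F) x a e := by
    intro a b
    have := second_fderiv_of_fderiv_eq hΩ hF hx (V := fun _ => b) (fun y hy => h y hy b)
      (hasFDerivAt_const b x) ((hasFDerivAt_fderiv_apply hΩ hF hx e).const_mul (l b)) a
    simpa using this
  rw [key a b, second_fderiv_comm hΩ hF hx, key e a]
  ring

theorem eq_of_hasFDerivAt_zero {f : E → ℝ} (hΩ : IsOpen Ω) (hΩc : IsConnected Ω)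
    (h : ∀ y ∈ Ω, HasFDerivAt f (0 : E →L[ℝ] ℝ) y) {x y : E} (hx : x ∈ Ω) (hy : y ∈ Ω) :
    f x = f y :=
  hΩ.is_const_of_fderiv_eq_zero hΩc.isPreconnected
    (fun z hz => (h z hz).differentiableAt.differentiableWithinAt)
    (fun z hz => (h z hz).fderiv) hx hy

end SecondDerivatives

/-! ### Coordinate fields of the space of variables -/

section Coordinates

variable {n : ℕ}

/-- The coordinate field `∂_u`. -/
def eu : Jet0 n := ((1, 0), 0, 0, 0)

/-- The coordinate field `∂_v`. -/
def ev : Jet0 n := ((0, 1), 0, 0, 0)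

/-- The coordinate field `∂_θ`. -/
def eθ : Jet0 n := ((0, 0), 1, 0, 0)

/-- `w ↦ ∑ w_k ∂_{α_k}`. -/
noncomputable def eα : (NormalIndex n → ℝ) →L[ℝ] Jet0 n :=
  (ContinuousLinearMap.inr ℝ _ _).comp
    ((ContinuousLinearMap.inr ℝ _ _).comp (ContinuousLinearMap.inl ℝ _ _))

/-- `w ↦ ∑ w_k ∂_{β_k}`. -/
noncomputable def eβ : (NormalIndex n → ℝ) →L[ℝ] Jet0 n :=
  (ContinuousLinearMap.inr ℝ _ _).comp
    ((ContinuousLinearMap.inr ℝ _ _).comp (ContinuousLinearMap.inr ℝ _ _))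

/-- The coordinate `u` as a linear form. -/
noncomputable def cu : Jet0 n →L[ℝ] ℝ :=
  (ContinuousLinearMap.fst ℝ _ _).comp (ContinuousLinearMap.fst ℝ _ _)

/-- The coordinate `v` as a linear form. -/
noncomputable def cv : Jet0 n →L[ℝ] ℝ :=
  (ContinuousLinearMap.snd ℝ _ _).comp (ContinuousLinearMap.fst ℝ _ _)

/-- The coordinate vector `α` as a linear map. -/
noncomputable def cα : Jet0 n →L[ℝ] (NormalIndex n → ℝ) :=
  (ContinuousLinearMap.fst ℝ _ _).comp
    ((ContinuousLinearMap.snd ℝ _ _).comp (ContinuousLinearMap.snd ℝ _ _))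

/-- The coordinate vector `β` as a linear map. -/
noncomputable def cβ : Jet0 n →L[ℝ] (NormalIndex n → ℝ) :=
  (ContinuousLinearMap.snd ℝ _ _).comp
    ((ContinuousLinearMap.snd ℝ _ _).comp (ContinuousLinearMap.snd ℝ _ _))

@[simp] theorem eα_apply (w : NormalIndex n → ℝ) : eα w = ((0, 0), 0, w, 0) := rfl
@[simp] theorem eβ_apply (w : NormalIndex n → ℝ) : eβ w = ((0, 0), 0, 0, w) := rfl
@[simp] theorem cu_apply (x : Jet0 n) : cu x = x.1.1 := rfl
@[simp] theorem cv_apply (x : Jet0 n) : cv x = x.1.2 := rfl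
@[simp] theorem cα_apply (x : Jet0 n) : cα x = x.2.2.1 := rfl
@[simp] theorem cβ_apply (x : Jet0 n) : cβ x = x.2.2.2 := rfl

theorem clm_apply_eq (f : Jet0 n →L[ℝ] ℝ) (a b t : ℝ) (x y : NormalIndex n → ℝ) :
    f ((a, b), t, x, y) = a * f eu + b * f ev + t * f eθ + f (eα x) + f (eβ y) := by
  have : (((a, b), t, x, y) : Jet0 n) = a • eu + b • ev + t • eθ + eα x + eβ y := by
    simp [eu, ev, eθ]
  rw [this]
  simp only [map_add, map_smul, smul_eq_mul]

theorem hasFDerivAt_α (j : NormalIndex n) (x : Jet0 n) :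
    HasFDerivAt (fun y : Jet0 n => y.2.2.1 j)
      ((ContinuousLinearMap.proj (R := ℝ) (φ := fun _ => ℝ) j).comp cα) x :=
  ((ContinuousLinearMap.proj (R := ℝ) (φ := fun _ => ℝ) j).comp cα).hasFDerivAt

theorem hasFDerivAt_β (j : NormalIndex n) (x : Jet0 n) :
    HasFDerivAt (fun y : Jet0 n => y.2.2.2 j)
      ((ContinuousLinearMap.proj (R := ℝ) (φ := fun _ => ℝ) j).comp cβ) x :=
  ((ContinuousLinearMap.proj (R := ℝ) (φ := fun _ => ℝ) j).comp cβ).hasFDerivAt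

end Coordinates

/-! ### Total derivatives -/

section TotalDerivativeFormulas

variable {n : ℕ} {Ω : Set (Jet0 n)} {F : Jet0 n → ℝ}

theorem Du_eq (z : Jet2 n) :
    Du F z = fderiv ℝ F z.jet0 ((1, 0), z.θ_u, z.α_u, z.β_u) := rfl

theorem Dv_eq (z : Jet2 n) :
    Dv F z = fderiv ℝ F z.jet0 ((0, 1), z.θ_v, z.α_v, z.β_v) := rfl

/-- The second total derivative on the second jet space is the Hessian along the first order
part of the jet, plus the differential along its second order part. -/
theorem Duu_eq (hΩ : IsOpen Ω) (hF : ContDiffOn ℝ 2 F Ω) (z : Jet2 n) (hz : z.jet0 ∈ Ω) :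
    Duu F z = fderiv ℝ (fderiv ℝ F) z.jet0 ((1, 0), z.θ_u, z.α_u, z.β_u)
        ((1, 0), z.θ_u, z.α_u, z.β_u)
      + fderiv ℝ F z.jet0 ((0, 0), z.θ_uu, z.α_uu, z.β_uu) := by
  have h1 : HasFDerivAt (fun w : Jet1 n => fderiv ℝ F w.1)
      ((fderiv ℝ (fderiv ℝ F) z.jet0).comp (ContinuousLinearMap.fst ℝ _ _)) z.jet1 :=
    HasFDerivAt.comp (g := fderiv ℝ F) z.jet1 (hasFDerivAt_fderiv hΩ hF hz) hasFDerivAt_fst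
  have h2 : HasFDerivAt (fun w : Jet1 n => (((1, 0), w.2.1) : Jet0 n))
      ((ContinuousLinearMap.inr ℝ _ _).comp
        ((ContinuousLinearMap.fst ℝ _ _).comp (ContinuousLinearMap.snd ℝ _ _))) z.jet1 :=
    ((ContinuousLinearMap.hasFDerivAt _).const_add (((1, 0), 0) : Jet0 n)).congr_of_eventuallyEq
      (.of_forall fun w => by simp)
  have h3 := (h1.clm_apply h2).fderiv
  unfold Duu totalU1
  change fderiv ℝ (fun w : Jet1 n => fderiv ℝ F w.1 ((1, 0), w.2.1)) z.jet1 _ = _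
  rw [h3]
  exact add_comm _ _

theorem Dvv_eq (hΩ : IsOpen Ω) (hF : ContDiffOn ℝ 2 F Ω) (z : Jet2 n) (hz : z.jet0 ∈ Ω) :
    Dvv F z = fderiv ℝ (fderiv ℝ F) z.jet0 ((0, 1), z.θ_v, z.α_v, z.β_v)
        ((0, 1), z.θ_v, z.α_v, z.β_v)
      + fderiv ℝ F z.jet0 ((0, 0), z.θ_vv, z.α_vv, z.β_vv) := by
  have h1 : HasFDerivAt (fun w : Jet1 n => fderiv ℝ F w.1)
      ((fderiv ℝ (fderiv ℝ F) z.jet0).comp (ContinuousLinearMap.fst ℝ _ _)) z.jet1 :=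
    HasFDerivAt.comp (g := fderiv ℝ F) z.jet1 (hasFDerivAt_fderiv hΩ hF hz) hasFDerivAt_fst
  have h2 : HasFDerivAt (fun w : Jet1 n => (((0, 1), w.2.2) : Jet0 n))
      ((ContinuousLinearMap.inr ℝ _ _).comp
        ((ContinuousLinearMap.snd ℝ _ _).comp (ContinuousLinearMap.snd ℝ _ _))) z.jet1 :=
    ((ContinuousLinearMap.hasFDerivAt _).const_add (((0, 1), 0) : Jet0 n)).congr_of_eventuallyEq
      (.of_forall fun w => by simp)
  have h3 := (h1.clm_apply h2).fderiv
  unfold Dvv totalV1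
  change fderiv ℝ (fun w : Jet1 n => fderiv ℝ F w.1 ((0, 1), w.2.2)) z.jet1 _ = _
  rw [h3]
  exact add_comm _ _

end TotalDerivativeFormulas

/-! ### Jets with free parametric derivatives -/

section FreeJets

variable {n : ℕ}

/-- The second jet over `x` that satisfies the Gauss–Codazzi system and its consequences and has
the prescribed parametric derivatives: `θ_u = p`, `θ_v = q`, `α_u = r`, `β_v = s`, `θ_uu = t`,
`α_uu = a`, `β_vv = b`, and `θ_uv = 0`. -/
def freeJet (x : Jet0 n) (p q : ℝ) (r s : NormalIndex n → ℝ) (t : ℝ)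
    (a b : NormalIndex n → ℝ) : Jet2 n where
  u := x.1.1
  v := x.1.2
  θ := x.2.1
  α := x.2.2.1
  β := x.2.2.2
  θ_u := p
  α_u := r
  β_u := p • x.2.2.1
  θ_v := q
  α_v := q • x.2.2.2
  β_v := s
  θ_uu := t
  α_uu := a
  β_uu := t • x.2.2.1 + p • r
  θ_uv := 0
  α_uv := q • p • x.2.2.1
  β_uv := p • q • x.2.2.2
  θ_vv := -t - ∑ j, x.2.2.1 j * x.2.2.2 j
  α_vv := (-t - ∑ j, x.2.2.1 j * x.2.2.2 j) • x.2.2.2 + q • s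
  β_vv := b

variable {Ω : Set (Jet0 n)} {X : PointVectorField n}

theorem determiningEquationsAt_freeJet (hD : X.DeterminingEquationsOn Ω) {x : Jet0 n}
    (hx : x ∈ Ω) (p q : ℝ) (r s : NormalIndex n → ℝ) (t : ℝ) (a b : NormalIndex n → ℝ) :
    X.DeterminingEquationsAt (freeJet x p q r s t a b) := by
  refine hD _ hx ⟨?_, ?_, ?_⟩ ⟨?_, ?_, ?_, ?_⟩
  · simp only [freeJet]
    ring
  all_goals simp [freeJet]

/-- The determining equation of `α_{j,v} = θ_v β_j` at a jet with free parametric derivatives. -/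
theorem codazzi_α (hD : X.DeterminingEquationsOn Ω) {x : Jet0 n} (hx : x ∈ Ω)
    (p q : ℝ) (r s : NormalIndex n → ℝ) (j : NormalIndex n) :
    fderiv ℝ (X.A j) x ((0, 1), q, q • x.2.2.2, s)
      - r j * fderiv ℝ X.ξ x ((0, 1), q, q • x.2.2.2, s)
      - q * x.2.2.2 j * fderiv ℝ X.η x ((0, 1), q, q • x.2.2.2, s)
    = (fderiv ℝ X.Φ x ((0, 1), q, q • x.2.2.2, s)
        - fderiv ℝ X.ξ x ((0, 1), q, q • x.2.2.2, s) * p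
        - fderiv ℝ X.η x ((0, 1), q, q • x.2.2.2, s) * q) * x.2.2.2 j + q * X.B j x :=
  (determiningEquationsAt_freeJet hD hx p q r s 0 0 0).2.1 j

/-- The determining equation of `β_{j,u} = θ_u α_j` at a jet with free parametric derivatives. -/
theorem codazzi_β (hD : X.DeterminingEquationsOn Ω) {x : Jet0 n} (hx : x ∈ Ω)
    (p q : ℝ) (r s : NormalIndex n → ℝ) (j : NormalIndex n) :
    fderiv ℝ (X.B j) x ((1, 0), p, r, p • x.2.2.1)
      - p * x.2.2.1 j * fderiv ℝ X.ξ x ((1, 0), p, r, p • x.2.2.1)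
      - s j * fderiv ℝ X.η x ((1, 0), p, r, p • x.2.2.1)
    = (fderiv ℝ X.Φ x ((1, 0), p, r, p • x.2.2.1)
        - fderiv ℝ X.ξ x ((1, 0), p, r, p • x.2.2.1) * p
        - fderiv ℝ X.η x ((1, 0), p, r, p • x.2.2.1) * q) * x.2.2.1 j + p * X.A j x :=
  (determiningEquationsAt_freeJet hD hx p q r s 0 0 0).2.2 j

theorem exists_normalIndex (hn : 3 ≤ n) : Nonempty (NormalIndex n) :=
  ⟨⟨3, Finset.mem_Icc.2 ⟨le_rfl, hn⟩⟩⟩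

/-- `D_v ξ` is the coefficient of the free derivative `α_{j,u}`. -/
theorem Dv_ξ_eq_zero (j : NormalIndex n) (hD : X.DeterminingEquationsOn Ω) {x : Jet0 n}
    (hx : x ∈ Ω) (q : ℝ) (s : NormalIndex n → ℝ) :
    fderiv ℝ X.ξ x ((0, 1), q, q • x.2.2.2, s) = 0 := by
  have h0 := codazzi_α hD hx 0 q 0 s j
  have h1 := codazzi_α hD hx 0 q 1 s j
  simp only [Pi.zero_apply, Pi.one_apply] at h0 h1
  linarith

/-- `D_u η` is the coefficient of the free derivative `β_{j,v}`. -/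
theorem Du_η_eq_zero (j : NormalIndex n) (hD : X.DeterminingEquationsOn Ω) {x : Jet0 n}
    (hx : x ∈ Ω) (p : ℝ) (r : NormalIndex n → ℝ) :
    fderiv ℝ X.η x ((1, 0), p, r, p • x.2.2.1) = 0 := by
  have h0 := codazzi_β hD hx p 0 r 0 j
  have h1 := codazzi_β hD hx p 0 r 1 j
  simp only [Pi.zero_apply, Pi.one_apply] at h0 h1
  linarith

/-- Comparison of coefficients in an identity that is affine in `q` and `s`. -/
theorem split_v {f : Jet0 n →L[ℝ] ℝ} {β : NormalIndex n → ℝ} {c : ℝ}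
    (h : ∀ (q : ℝ) (s : NormalIndex n → ℝ), f ((0, 1), q, q • β, s) = q * c) :
    f ev = 0 ∧ (∀ s, f (eβ s) = 0) ∧ f (eθ + eα β) = c := by
  have h' : ∀ (q : ℝ) (s : NormalIndex n → ℝ),
      f ev + q * f eθ + q * f (eα β) + f (eβ s) = q * c := by
    intro q s
    have := h q s
    rw [clm_apply_eq, map_smul, map_smul] at this
    simpa using this
  have h0 := h' 0 0
  have h1 := h' 1 0
  rw [map_zero, map_zero] at h0 h1
  refine ⟨by linarith, fun s => ?_, ?_⟩
  · have := h' 0 s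
    linarith
  · rw [map_add]; linarith

/-- Comparison of coefficients in an identity that is affine in `p` and `r`. -/
theorem split_u {f : Jet0 n →L[ℝ] ℝ} {α : NormalIndex n → ℝ} {c : ℝ}
    (h : ∀ (p : ℝ) (r : NormalIndex n → ℝ), f ((1, 0), p, r, p • α) = p * c) :
    f eu = 0 ∧ (∀ r, f (eα r) = 0) ∧ f (eθ + eβ α) = c := by
  have h' : ∀ (p : ℝ) (r : NormalIndex n → ℝ),
      f eu + p * f eθ + f (eα r) + p * f (eβ α) = p * c := by
    intro q s
    have := h q s
    rw [clm_apply_eq, map_smul, map_smul] at this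
    simpa using this
  have h0 := h' 0 0
  have h1 := h' 1 0
  rw [map_zero, map_zero] at h0 h1
  refine ⟨by linarith, fun s => ?_, ?_⟩
  · have := h' 0 s
    linarith
  · rw [map_add]; linarith

end FreeJets

/-! ### Splitting of the determining equations -/

section FirstReduction

variable {n : ℕ} {Ω : Set (Jet0 n)} {X : PointVectorField n}

/-- `ξ` depends on `u` only. -/
theorem fderiv_ξ (hn : 3 ≤ n) (hΩ : IsOpen Ω) (hX : X.IsC2On Ω) (hD : X.DeterminingEquationsOn Ω) :
    ∀ x ∈ Ω, ∀ d, fderiv ℝ X.ξ x d = d.1.1 * fderiv ℝ X.ξ x eu := by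
  obtain ⟨j⟩ := exists_normalIndex hn
  have h : ∀ y ∈ Ω, _ := fun y hy => split_v (f := fderiv ℝ X.ξ y) (β := y.2.2.2) (c := 0)
    fun q s => by rw [Dv_ξ_eq_zero j hD hy, mul_zero]
  intro x hx d
  have hα : ∀ w, fderiv ℝ X.ξ x (eα w) = 0 := fun w => by
    simpa using fderiv_eq_of_transport hΩ hX.1 hx (e := eθ) (i := eβ) (j := eα) (c := cβ)
      (fun _ => rfl) (fun y hy => (h y hy).2.1) (fun y hy => (h y hy).2.2)
      (hasFDerivAt_const 0 x) w
  obtain ⟨h1, h2, h3⟩ := h x hx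
  rw [map_add, hα, add_zero] at h3
  obtain ⟨⟨a, b⟩, t, α, β⟩ := d
  rw [clm_apply_eq, h1, h2, h3, hα]
  ring

/-- `η` depends on `v` only. -/
theorem fderiv_η (hn : 3 ≤ n) (hΩ : IsOpen Ω) (hX : X.IsC2On Ω) (hD : X.DeterminingEquationsOn Ω) :
    ∀ x ∈ Ω, ∀ d, fderiv ℝ X.η x d = d.1.2 * fderiv ℝ X.η x ev := by
  obtain ⟨j⟩ := exists_normalIndex hn
  have h : ∀ y ∈ Ω, _ := fun y hy => split_u (f := fderiv ℝ X.η y) (α := y.2.2.1) (c := 0)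
    fun q s => by rw [Du_η_eq_zero j hD hy, mul_zero]
  intro x hx d
  have hβ : ∀ w, fderiv ℝ X.η x (eβ w) = 0 := fun w => by
    simpa using fderiv_eq_of_transport hΩ hX.2.1 hx (e := eθ) (i := eα) (j := eβ) (c := cα)
      (fun _ => rfl) (fun y hy => (h y hy).2.1) (fun y hy => (h y hy).2.2)
      (hasFDerivAt_const 0 x) w
  obtain ⟨h1, h2, h3⟩ := h x hx
  rw [map_add, hβ, add_zero] at h3
  obtain ⟨⟨a, b⟩, t, α, β⟩ := d
  rw [clm_apply_eq, h1, h2, h3, hβ]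
  ring

/-- The Gauss equation at a jet with free parametric derivatives, once `ξ = ξ(u)` and
`η = η(v)`. -/
theorem gauss (hn : 3 ≤ n) (hΩ : IsOpen Ω) (hX : X.IsC2On Ω) (hD : X.DeterminingEquationsOn Ω)
    {x : Jet0 n} (hx : x ∈ Ω) (p q : ℝ) (r s : NormalIndex n → ℝ) (t : ℝ)
    (a b : NormalIndex n → ℝ) :
    (fderiv ℝ (fderiv ℝ X.Φ) x ((1, 0), p, r, p • x.2.2.1) ((1, 0), p, r, p • x.2.2.1)
        + fderiv ℝ X.Φ x ((0, 0), t, a, t • x.2.2.1 + p • r))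
      - fderiv ℝ (fderiv ℝ X.ξ) x eu eu * p - 2 * fderiv ℝ X.ξ x eu * t
      + (fderiv ℝ (fderiv ℝ X.Φ) x ((0, 1), q, q • x.2.2.2, s) ((0, 1), q, q • x.2.2.2, s)
        + fderiv ℝ X.Φ x ((0, 0), -t - ∑ j, x.2.2.1 j * x.2.2.2 j,
          (-t - ∑ j, x.2.2.1 j * x.2.2.2 j) • x.2.2.2 + q • s, b))
      - fderiv ℝ (fderiv ℝ X.η) x ev ev * q
      - 2 * fderiv ℝ X.η x ev * (-t - ∑ j, x.2.2.1 j * x.2.2.2 j)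
      + ∑ k, X.A k x * x.2.2.2 k + ∑ k, x.2.2.1 k * X.B k x = 0 := by
  have h := (determiningEquationsAt_freeJet hD hx p q r s t a b).1
  have hz : (freeJet x p q r s t a b).jet0 ∈ Ω := hx
  have hz0 : (freeJet x p q r s t a b).jet0 = x := rfl
  obtain ⟨kξ, hkξ⟩ : ∃ k, k = fderiv ℝ X.ξ x eu := ⟨_, rfl⟩
  obtain ⟨lξ, hlξ⟩ : ∃ l, l = fderiv ℝ (fderiv ℝ X.ξ) x eu eu := ⟨_, rfl⟩
  have hξ : ∀ c d, fderiv ℝ X.ξ x (c, d) = c.1 * kξ :=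
    fun c d => hkξ ▸ fderiv_ξ hn hΩ hX hD x hx (c, d)
  obtain ⟨kη, hkη⟩ : ∃ k, k = fderiv ℝ X.η x ev := ⟨_, rfl⟩
  obtain ⟨lη, hlη⟩ : ∃ l, l = fderiv ℝ (fderiv ℝ X.η) x ev ev := ⟨_, rfl⟩
  have hη : ∀ c d, fderiv ℝ X.η x (c, d) = c.2 * kη :=
    fun c d => hkη ▸ fderiv_η hn hΩ hX hD x hx (c, d)
  have hξ2 : ∀ c d, fderiv ℝ (fderiv ℝ X.ξ) x (c, d) (c, d)
      = c.1 * c.1 * lξ := fun c d => hlξ ▸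
    second_fderiv_of_fderiv_eq_mul hΩ hX.1 hx (fderiv_ξ hn hΩ hX hD) (c, d) (c, d)
  have hη2 : ∀ c d, fderiv ℝ (fderiv ℝ X.η) x (c, d) (c, d)
      = c.2 * c.2 * lη := fun c d => hlη ▸
    second_fderiv_of_fderiv_eq_mul hΩ hX.2.1 hx (fderiv_η hn hΩ hX hD) (c, d) (c, d)
  rw [PointVectorField.Φuu, PointVectorField.Φvv, Duu_eq hΩ hX.1 _ hz, Duu_eq hΩ hX.2.1 _ hz,
    Duu_eq hΩ hX.2.2.1 _ hz, Dvv_eq hΩ hX.1 _ hz, Dvv_eq hΩ hX.2.1 _ hz,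
    Dvv_eq hΩ hX.2.2.1 _ hz, Du_eq, Du_eq, Dv_eq, Dv_eq, hz0] at h
  simp only [hξ, hη, hξ2, hη2, freeJet] at h
  rw [← hkξ, ← hkη, ← hlξ, ← hlη]
  linarith

/-- `Φ_α` is the coefficient of the free second derivative `α_uu` in the Gauss equation. -/
theorem fderiv_Φ_α (hn : 3 ≤ n) (hΩ : IsOpen Ω) (hX : X.IsC2On Ω)
    (hD : X.DeterminingEquationsOn Ω) {x : Jet0 n} (hx : x ∈ Ω) (w : NormalIndex n → ℝ) :
    fderiv ℝ X.Φ x (eα w) = 0 := by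
  have h0 := gauss hn hΩ hX hD hx 0 0 0 0 0 0 0
  have h1 := gauss hn hΩ hX hD hx 0 0 0 0 0 w 0
  have h2 : fderiv ℝ X.Φ x ((0, 0), 0, w, 0) =
      fderiv ℝ X.Φ x (((0, 0), 0, 0, 0) : Jet0 n) + fderiv ℝ X.Φ x (eα w) := by
    rw [← map_add]; simp
  simp only [zero_smul, add_zero] at h0 h1
  linarith

/-- `Φ_β` is the coefficient of the free second derivative `β_vv` in the Gauss equation. -/
theorem fderiv_Φ_β (hn : 3 ≤ n) (hΩ : IsOpen Ω) (hX : X.IsC2On Ω)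
    (hD : X.DeterminingEquationsOn Ω) {x : Jet0 n} (hx : x ∈ Ω) (w : NormalIndex n → ℝ) :
    fderiv ℝ X.Φ x (eβ w) = 0 := by
  have h0 := gauss hn hΩ hX hD hx 0 0 0 0 0 0 0
  have h1 := gauss hn hΩ hX hD hx 0 0 0 0 0 0 w
  rw [clm_apply_eq _ _ _ (-0 - _), map_zero eβ, map_zero (fderiv ℝ X.Φ x)] at h0
  rw [clm_apply_eq _ _ _ (-0 - _)] at h1
  linarith

/-- The Codazzi equations for `A^j`, split with respect to the free derivatives `θ_v`, `β_v`. -/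
theorem fderiv_A (hn : 3 ≤ n) (hΩ : IsOpen Ω) (hX : X.IsC2On Ω) (hD : X.DeterminingEquationsOn Ω)
    {x : Jet0 n} (hx : x ∈ Ω) (j : NormalIndex n) :
    fderiv ℝ (X.A j) x ev = x.2.2.2 j * fderiv ℝ X.Φ x ev ∧
    (∀ w, fderiv ℝ (X.A j) x (eβ w) = 0) ∧
    fderiv ℝ (X.A j) x (eθ + eα x.2.2.2) = x.2.2.2 j * fderiv ℝ X.Φ x eθ + X.B j x := by
  have h := split_v (f := fderiv ℝ (X.A j) x - x.2.2.2 j • fderiv ℝ X.Φ x) (β := x.2.2.2)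
    (c := X.B j x) fun q s => by
      have := codazzi_α hD hx 0 q 0 s j
      rw [Dv_ξ_eq_zero j hD hx] at this
      simp only [sub_apply, smul_apply, smul_eq_mul]
      linarith
  obtain ⟨h1, h2, h3⟩ := h
  simp only [sub_apply, smul_apply, smul_eq_mul,
    fderiv_Φ_β hn hΩ hX hD hx, mul_zero, sub_zero] at h1 h2 h3
  rw [map_add (fderiv ℝ X.Φ x), fderiv_Φ_α hn hΩ hX hD hx] at h3
  exact ⟨by linarith, h2, by linarith⟩

/-- The Codazzi equations for `B^j`, split with respect to the free derivatives `θ_u`, `α_u`. -/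
theorem fderiv_B (hn : 3 ≤ n) (hΩ : IsOpen Ω) (hX : X.IsC2On Ω) (hD : X.DeterminingEquationsOn Ω)
    {x : Jet0 n} (hx : x ∈ Ω) (j : NormalIndex n) :
    fderiv ℝ (X.B j) x eu = x.2.2.1 j * fderiv ℝ X.Φ x eu ∧
    (∀ w, fderiv ℝ (X.B j) x (eα w) = 0) ∧
    fderiv ℝ (X.B j) x (eθ + eβ x.2.2.1) = x.2.2.1 j * fderiv ℝ X.Φ x eθ + X.A j x := by
  have h := split_u (f := fderiv ℝ (X.B j) x - x.2.2.1 j • fderiv ℝ X.Φ x) (α := x.2.2.1)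
    (c := X.A j x) fun q s => by
      have := codazzi_β hD hx q 0 s 0 j
      rw [Du_η_eq_zero j hD hx] at this
      simp only [sub_apply, smul_apply, smul_eq_mul]
      linarith
  obtain ⟨h1, h2, h3⟩ := h
  simp only [sub_apply, smul_apply, smul_eq_mul,
    fderiv_Φ_α hn hΩ hX hD hx, mul_zero, sub_zero] at h1 h2 h3
  rw [map_add (fderiv ℝ X.Φ x), fderiv_Φ_β hn hΩ hX hD hx] at h3
  exact ⟨by linarith, h2, by linarith⟩

theorem fderiv_Φ_ev (hn : 3 ≤ n) (hΩ : IsOpen Ω) (hX : X.IsC2On Ω)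
    (hD : X.DeterminingEquationsOn Ω) {x : Jet0 n} (hx : x ∈ Ω) : fderiv ℝ X.Φ x ev = 0 := by
  obtain ⟨j⟩ := exists_normalIndex hn
  -- `A^j` does not depend on `β`, so neither does `A^j_v = β_j Φ_v`.
  have h := second_fderiv_of_fderiv_eq hΩ (hX.2.2.2.1 j) hx (V := fun _ => ev)
    (fun y hy => (fderiv_A hn hΩ hX hD hy j).1) (hasFDerivAt_const _ x)
    ((hasFDerivAt_β j x).mul (hasFDerivAt_fderiv_apply hΩ hX.2.2.1 hx ev)) (eβ 1)
  rw [second_fderiv_eq_zero' hΩ (hX.2.2.2.1 j) hx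
    (fun y hy => (fderiv_A hn hΩ hX hD hy j).2.1 1)] at h
  have h2 := second_fderiv_eq_zero' hΩ hX.2.2.1 hx
    (fun y hy => fderiv_Φ_β hn hΩ hX hD hy 1) ev
  simp only [eβ_apply] at h2
  simpa [h2] using h.symm

theorem fderiv_Φ_eu (hn : 3 ≤ n) (hΩ : IsOpen Ω) (hX : X.IsC2On Ω)
    (hD : X.DeterminingEquationsOn Ω) {x : Jet0 n} (hx : x ∈ Ω) : fderiv ℝ X.Φ x eu = 0 := by
  obtain ⟨j⟩ := exists_normalIndex hn
  -- `B^j` does not depend on `α`, so neither does `B^j_u = α_j Φ_u`.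
  have h := second_fderiv_of_fderiv_eq hΩ (hX.2.2.2.2 j) hx (V := fun _ => eu)
    (fun y hy => (fderiv_B hn hΩ hX hD hy j).1) (hasFDerivAt_const _ x)
    ((hasFDerivAt_α j x).mul (hasFDerivAt_fderiv_apply hΩ hX.2.2.1 hx eu)) (eα 1)
  rw [second_fderiv_eq_zero' hΩ (hX.2.2.2.2 j) hx
    (fun y hy => (fderiv_B hn hΩ hX hD hy j).2.1 1)] at h
  have h2 := second_fderiv_eq_zero' hΩ hX.2.2.1 hx
    (fun y hy => fderiv_Φ_α hn hΩ hX hD hy 1) eu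
  simp only [eα_apply] at h2
  simpa [h2] using h.symm

/-- The Jacobians satisfy both `A_α = B_β + Φ_θ • 1` and `B_β = A_α + Φ_θ • 1`; hence `Φ_θ = 0`
and `A_α = B_β`. -/
theorem fderiv_Φ_eθ_and_jacobian (hn : 3 ≤ n) (hΩ : IsOpen Ω) (hX : X.IsC2On Ω)
    (hD : X.DeterminingEquationsOn Ω) {x : Jet0 n} (hx : x ∈ Ω) :
    fderiv ℝ X.Φ x eθ = 0 ∧
    ∀ j w, fderiv ℝ (X.A j) x (eα w) = fderiv ℝ (X.B j) x (eβ w) := by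
  have hA : ∀ j w, fderiv ℝ (X.A j) x (eα w)
      = w j * fderiv ℝ X.Φ x eθ + fderiv ℝ (X.B j) x (eβ w) := by
    intro j w
    have h := fderiv_eq_of_transport hΩ (hX.2.2.2.1 j) hx (e := eθ) (i := eβ) (j := eα) (c := cβ)
      (fun _ => rfl) (fun y hy => (fderiv_A hn hΩ hX hD hy j).2.1)
      (fun y hy => (fderiv_A hn hΩ hX hD hy j).2.2)
      (((hasFDerivAt_β j x).mul (hasFDerivAt_fderiv_apply hΩ hX.2.2.1 hx eθ)).add
        (hasFDerivAt_of_contDiffOn hΩ (hX.2.2.2.2 j) hx)) w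
    have h2 := second_fderiv_eq_zero' hΩ hX.2.2.1 hx
      (fun y hy => fderiv_Φ_β hn hΩ hX hD hy w) eθ
    simp only [eβ_apply] at h2
    simp [h2] at h
    simp only [eα_apply, eβ_apply]
    linarith
  have hB : ∀ j w, fderiv ℝ (X.B j) x (eβ w)
      = w j * fderiv ℝ X.Φ x eθ + fderiv ℝ (X.A j) x (eα w) := by
    intro j w
    have h := fderiv_eq_of_transport hΩ (hX.2.2.2.2 j) hx (e := eθ) (i := eα) (j := eβ) (c := cα)
      (fun _ => rfl) (fun y hy => (fderiv_B hn hΩ hX hD hy j).2.1)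
      (fun y hy => (fderiv_B hn hΩ hX hD hy j).2.2)
      (((hasFDerivAt_α j x).mul (hasFDerivAt_fderiv_apply hΩ hX.2.2.1 hx eθ)).add
        (hasFDerivAt_of_contDiffOn hΩ (hX.2.2.2.1 j) hx)) w
    have h2 := second_fderiv_eq_zero' hΩ hX.2.2.1 hx
      (fun y hy => fderiv_Φ_α hn hΩ hX hD hy w) eθ
    simp only [eα_apply] at h2
    simp [h2] at h
    simp only [eα_apply, eβ_apply]
    linarith
  have h0 : fderiv ℝ X.Φ x eθ = 0 := by
    obtain ⟨j⟩ := exists_normalIndex hn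
    have h1 := hA j 1
    have h2 := hB j 1
    simp only [Pi.one_apply] at h1 h2
    linarith
  exact ⟨h0, fun j w => by rw [hA, h0]; ring⟩

theorem fderiv_Φ (hn : 3 ≤ n) (hΩ : IsOpen Ω) (hX : X.IsC2On Ω)
    (hD : X.DeterminingEquationsOn Ω) {x : Jet0 n} (hx : x ∈ Ω) : fderiv ℝ X.Φ x = 0 := by
  refine ContinuousLinearMap.ext fun ⟨⟨a, b⟩, t, α, β⟩ => ?_
  rw [clm_apply_eq, fderiv_Φ_eu hn hΩ hX hD hx, fderiv_Φ_ev hn hΩ hX hD hx,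
    (fderiv_Φ_eθ_and_jacobian hn hΩ hX hD hx).1, fderiv_Φ_α hn hΩ hX hD hx,
    fderiv_Φ_β hn hΩ hX hD hx]
  simp

/-- What the Gauss equation leaves: `ξ'' = η'' = 0`, `ξ' = η'`, and an algebraic relation. -/
theorem gauss_split (hn : 3 ≤ n) (hΩ : IsOpen Ω) (hX : X.IsC2On Ω)
    (hD : X.DeterminingEquationsOn Ω) {x : Jet0 n} (hx : x ∈ Ω) :
    fderiv ℝ (fderiv ℝ X.ξ) x eu eu = 0 ∧ fderiv ℝ X.ξ x eu = fderiv ℝ X.η x ev ∧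
    2 * fderiv ℝ X.ξ x eu * ∑ j, x.2.2.1 j * x.2.2.2 j
      + ∑ k, X.A k x * x.2.2.2 k + ∑ k, x.2.2.1 k * X.B k x = 0 := by
  have hΦ : ∀ d, fderiv ℝ X.Φ x d = 0 := fun d => by rw [fderiv_Φ hn hΩ hX hD hx]; rfl
  have hΦ2 : ∀ a b, fderiv ℝ (fderiv ℝ X.Φ) x a b = 0 := fun a b =>
    second_fderiv_eq_zero hΩ hX.2.2.1 hx (fun y hy => by rw [fderiv_Φ hn hΩ hX hD hy]; rfl) a
  have h : ∀ p t : ℝ, _ := fun p t => gauss hn hΩ hX hD hx p 0 0 0 t 0 0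
  simp only [hΦ, hΦ2, mul_zero] at h
  have h00 := h 0 0
  have h10 := h 1 0
  have h01 := h 0 1
  have e : fderiv ℝ X.ξ x eu = fderiv ℝ X.η x ev := by linarith
  refine ⟨by linarith, e, ?_⟩
  rw [e]
  linarith

end FirstReduction

/-! ### Integration to constants -/

section SecondReduction

variable {n : ℕ} {Ω : Set (Jet0 n)} {X : PointVectorField n}

/-- The Jacobian of `A` with respect to `α` is locally constant. -/
theorem second_fderiv_A (hn : 3 ≤ n) (hΩ : IsOpen Ω) (hX : X.IsC2On Ω)
    (hD : X.DeterminingEquationsOn Ω) {x : Jet0 n} (hx : x ∈ Ω) (j : NormalIndex n)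
    (w : NormalIndex n → ℝ) (d : Jet0 n) : fderiv ℝ (fderiv ℝ (X.A j)) x d (eα w) = 0 := by
  have hA := hX.2.2.2.1 j
  have hB := hX.2.2.2.2 j
  have hv : fderiv ℝ (fderiv ℝ (X.A j)) x ev (eα w) = 0 :=
    second_fderiv_eq_zero' hΩ hA hx (fun y hy => by
      rw [(fderiv_A hn hΩ hX hD hy j).1, fderiv_Φ_ev hn hΩ hX hD hy, mul_zero]) _
  have hβ : ∀ s, fderiv ℝ (fderiv ℝ (X.A j)) x (eβ s) (eα w) = 0 := fun s =>
    second_fderiv_eq_zero' hΩ hA hx (fun y hy => (fderiv_A hn hΩ hX hD hy j).2.1 s) _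
  -- In the remaining directions, use that the Jacobian is also that of `B` with respect to `β`.
  have hAB : ∀ d, fderiv ℝ (fderiv ℝ (X.A j)) x d (eα w)
      = fderiv ℝ (fderiv ℝ (X.B j)) x d (eβ w) := fun d => by
    simpa using second_fderiv_of_fderiv_eq hΩ hA hx (V := fun _ => eα w)
      (fun y hy => (fderiv_Φ_eθ_and_jacobian hn hΩ hX hD hy).2 j w)
      (hasFDerivAt_const _ x) (hasFDerivAt_fderiv_apply hΩ hB hx (eβ w)) d
  have hu : fderiv ℝ (fderiv ℝ (X.A j)) x eu (eα w) = 0 := by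
    rw [hAB]
    exact second_fderiv_eq_zero' hΩ hB hx (fun y hy => by
      rw [(fderiv_B hn hΩ hX hD hy j).1, fderiv_Φ_eu hn hΩ hX hD hy, mul_zero]) _
  have hα : ∀ r, fderiv ℝ (fderiv ℝ (X.A j)) x (eα r) (eα w) = 0 := fun r => by
    rw [hAB]
    exact second_fderiv_eq_zero' hΩ hB hx (fun y hy => (fderiv_B hn hΩ hX hD hy j).2.1 r) _
  have hθ : fderiv ℝ (fderiv ℝ (X.A j)) x eθ (eα w) = 0 := by
    have h := second_fderiv_of_fderiv_eq hΩ hA hx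
      (V := fun y => eθ + eα (cβ y)) (G := X.B j)
      (fun y hy => by
        have := (fderiv_A hn hΩ hX hD hy j).2.2
        rwa [(fderiv_Φ_eθ_and_jacobian hn hΩ hX hD hy).1, mul_zero, zero_add] at this)
      ((eα.comp cβ).hasFDerivAt.const_add eθ)
      (hasFDerivAt_of_contDiffOn hΩ hB hx) (eα w)
    have h0 : (eα.comp cβ) (eα w) = (0 : Jet0 n) := rfl
    rw [(fderiv_B hn hΩ hX hD hx j).2.1, h0, map_zero, map_add,
      second_fderiv_comm hΩ hA hx _ (eα (cβ x)), hα, second_fderiv_comm hΩ hA hx] at h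
    linarith
  obtain ⟨⟨a, b⟩, t, α, β⟩ := d
  rw [second_fderiv_comm hΩ hA hx, clm_apply_eq]
  simp only [second_fderiv_comm hΩ hA hx (eα w), hu, hv, hθ, hα, hβ]
  ring

theorem sum_mul_single (f : NormalIndex n → ℝ) (k : NormalIndex n) :
    ∑ l, f l * (Pi.single k 1 : NormalIndex n → ℝ) l = f k := by
  simp [Pi.single_apply, -Finset.univ_eq_attach]

/-- The vector field is determined by `ξ'`, the value of `Φ` and the Jacobian matrix of `A`. -/
theorem exists_constants (hn : 3 ≤ n) (hΩ : IsOpen Ω) (hΩc : IsConnected Ω) (hX : X.IsC2On Ω)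
    (hD : X.DeterminingEquationsOn Ω) :
    ∃ (c₀ c₁ c₂ c₃ : ℝ) (a : Matrix (NormalIndex n) (NormalIndex n) ℝ),
      (∀ j k, a j k = - a k j) ∧
      ∀ x ∈ Ω, X.ξ x = c₀ * x.1.1 + c₁ ∧ X.η x = c₀ * x.1.2 + c₂ ∧ X.Φ x = c₃ ∧
        (∀ j, X.A j x = ∑ k, a j k * x.2.2.1 k - c₀ * x.2.2.1 j) ∧
        (∀ j, X.B j x = ∑ k, a j k * x.2.2.2 k - c₀ * x.2.2.2 j) := by
  obtain ⟨x₀, hx₀⟩ := hΩc.nonempty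
  have hξ := fderiv_ξ hn hΩ hX hD
  have hη := fderiv_η hn hΩ hX hD
  obtain ⟨c, hc⟩ : ∃ c, c = fderiv ℝ X.ξ x₀ eu := ⟨_, rfl⟩
  have hcx : ∀ x ∈ Ω, fderiv ℝ X.ξ x eu = c := fun x hx => by
    rw [hc]
    refine eq_of_hasFDerivAt_zero hΩ hΩc (f := fun y => fderiv ℝ X.ξ y eu) (fun y hy => ?_) hx hx₀
    refine (hasFDerivAt_fderiv_apply hΩ hX.1 hy eu).congr_fderiv
      (ContinuousLinearMap.ext fun d => ?_)
    change fderiv ℝ (fderiv ℝ X.ξ) y d eu = 0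
    rw [second_fderiv_of_fderiv_eq_mul hΩ hX.1 hy hξ, (gauss_split hn hΩ hX hD hy).1, mul_zero]
  have hξc : ∀ x ∈ Ω, X.ξ x - c * x.1.1 = X.ξ x₀ - c * x₀.1.1 := fun x hx => by
    refine eq_of_hasFDerivAt_zero hΩ hΩc (f := fun y => X.ξ y - c * y.1.1) (fun y hy => ?_) hx hx₀
    refine ((hasFDerivAt_of_contDiffOn hΩ hX.1 hy).sub
      ((cu.hasFDerivAt (x := y)).const_mul c)).congr_fderiv (ContinuousLinearMap.ext fun d => ?_)
    simp [hξ y hy d, hcx y hy, mul_comm]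
  have hηc : ∀ x ∈ Ω, X.η x - c * x.1.2 = X.η x₀ - c * x₀.1.2 := fun x hx => by
    refine eq_of_hasFDerivAt_zero hΩ hΩc (f := fun y => X.η y - c * y.1.2) (fun y hy => ?_) hx hx₀
    refine ((hasFDerivAt_of_contDiffOn hΩ hX.2.1 hy).sub
      ((cv.hasFDerivAt (x := y)).const_mul c)).congr_fderiv (ContinuousLinearMap.ext fun d => ?_)
    simp [hη y hy d, ← (gauss_split hn hΩ hX hD hy).2.1, hcx y hy, mul_comm]
  have hΦc : ∀ x ∈ Ω, X.Φ x = X.Φ x₀ := fun x hx =>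
    eq_of_hasFDerivAt_zero hΩ hΩc (fun y hy => fderiv_Φ hn hΩ hX hD hy ▸
      hasFDerivAt_of_contDiffOn hΩ hX.2.2.1 hy) hx hx₀
  obtain ⟨m, hm⟩ : ∃ m : NormalIndex n → NormalIndex n → ℝ,
      ∀ j k, ∀ x ∈ Ω, fderiv ℝ (X.A j) x (eα (Pi.single k 1)) = m j k := by
    refine ⟨fun j k => fderiv ℝ (X.A j) x₀ (eα (Pi.single k 1)), fun j k x hx => ?_⟩
    refine eq_of_hasFDerivAt_zero hΩ hΩc (f := fun y => fderiv ℝ (X.A j) y (eα (Pi.single k 1)))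
      (fun y hy => ?_) hx hx₀
    refine (hasFDerivAt_fderiv_apply hΩ (hX.2.2.2.1 j) hy _).congr_fderiv
      (ContinuousLinearMap.ext fun d => ?_)
    exact second_fderiv_A hn hΩ hX hD hy j _ d
  have hmB : ∀ j k, ∀ x ∈ Ω, fderiv ℝ (X.B j) x (eβ (Pi.single k 1)) = m j k := fun j k x hx => by
    rw [← (fderiv_Φ_eθ_and_jacobian hn hΩ hX hD hx).2, hm j k x hx]
  -- The algebraic relation of the Gauss equation, differentiated along `Ω`.
  have hrel : ∀ x ∈ Ω, ∀ d : Jet0 n,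
      2 * c * ∑ k, (x.2.2.1 k * d.2.2.2 k + x.2.2.2 k * d.2.2.1 k)
        + ∑ k, (X.A k x * d.2.2.2 k + x.2.2.2 k * fderiv ℝ (X.A k) x d)
        + ∑ k, (x.2.2.1 k * fderiv ℝ (X.B k) x d + X.B k x * d.2.2.1 k) = 0 := by
    intro x hx d
    have h1 := (((HasFDerivAt.fun_sum (u := Finset.univ) fun k _ =>
        (hasFDerivAt_α k x).mul (hasFDerivAt_β k x)).const_mul (2 * c)).add
      (HasFDerivAt.fun_sum (u := Finset.univ) fun k _ =>
        (hasFDerivAt_of_contDiffOn hΩ (hX.2.2.2.1 k) hx).mul (hasFDerivAt_β k x))).add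
      (HasFDerivAt.fun_sum (u := Finset.univ) fun k _ =>
        (hasFDerivAt_α k x).mul (hasFDerivAt_of_contDiffOn hΩ (hX.2.2.2.2 k) hx))
    have h2 := h1.unique ((hasFDerivAt_const (0 : ℝ) x).congr_of_eventuallyEq (by
      filter_upwards [hΩ.mem_nhds hx] with y hy
      have := (gauss_split hn hΩ hX hD hy).2.2
      rw [hcx y hy] at this
      exact this))
    have h3 := congrArg (fun L : Jet0 n →L[ℝ] ℝ => L d) h2
    simpa [-Finset.univ_eq_attach] using h3
  have hAx : ∀ x ∈ Ω, ∀ k, X.A k x = -∑ l, x.2.2.1 l * m l k - 2 * c * x.2.2.1 k := by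
    intro x hx k
    have h := hrel x hx (eβ (Pi.single k 1))
    simp only [hmB _ _ x hx, (fderiv_A hn hΩ hX hD hx _).2.1] at h
    simp only [eβ_apply, Pi.zero_apply, mul_zero, add_zero, sum_mul_single] at h
    linarith
  have hBx : ∀ x ∈ Ω, ∀ k, X.B k x = -∑ l, x.2.2.2 l * m l k - 2 * c * x.2.2.2 k := by
    intro x hx k
    have h := hrel x hx (eα (Pi.single k 1))
    simp only [hm _ _ x hx, (fderiv_B hn hΩ hX hD hx _).2.1] at h
    simp only [eα_apply, Pi.zero_apply, mul_zero, zero_add, sum_mul_single] at h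
    linarith
  -- Differentiating `A^j = -∑ m^{lj} α_l - 2 c α_j` once more relates `m` to its transpose.
  have hmm : ∀ j k, m j k = - m k j - 2 * c * (Pi.single k 1 : NormalIndex n → ℝ) j := by
    intro j k
    have h1 := ((HasFDerivAt.fun_sum (u := Finset.univ) fun l _ =>
      (hasFDerivAt_α l x₀).mul_const (m l j)).neg.sub ((hasFDerivAt_α j x₀).const_mul (2 * c)))
    have h2 := (hasFDerivAt_of_contDiffOn hΩ (hX.2.2.2.1 j) hx₀).unique
      (h1.congr_of_eventuallyEq (by
        filter_upwards [hΩ.mem_nhds hx₀] with y hy using hAx y hy j))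
    rw [← hm j k x₀ hx₀, h2]
    simp [-Finset.univ_eq_attach, sum_mul_single]
  have hδ : ∀ j k : NormalIndex n,
      (Pi.single k 1 : NormalIndex n → ℝ) j = (Pi.single j 1 : NormalIndex n → ℝ) k := by
    intro j k
    simp only [Pi.single_apply, eq_comm]
  refine ⟨c, X.ξ x₀ - c * x₀.1.1, X.η x₀ - c * x₀.1.2, X.Φ x₀,
    fun j k => m j k + c * (Pi.single k 1 : NormalIndex n → ℝ) j, fun j k => ?_,
    fun x hx => ⟨by linarith [hξc x hx], by linarith [hηc x hx], hΦc x hx,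
      fun j => ?_, fun j => ?_⟩⟩
  · simp only
    rw [hmm j k, hδ k j]
    ring
  all_goals
    have hsum : ∀ f : NormalIndex n → ℝ,
        ∑ k, (m j k + c * (Pi.single k 1 : NormalIndex n → ℝ) j) * f k
          = -∑ l, f l * m l j - c * f j := fun f => by
      rw [← sum_mul_single f j, Finset.mul_sum, ← Finset.sum_neg_distrib,
        ← Finset.sum_sub_distrib]
      refine Finset.sum_congr rfl fun k _ => ?_
      rw [hmm j k, hδ j k]
      ring
  · rw [hAx x hx, hsum]; ring
  · rw [hBx x hx, hsum]; ring

end SecondReduction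

/-! ### The listed vector fields are symmetries -/

section Converse

variable {n : ℕ} {Ω : Set (Jet0 n)}

theorem fderiv_eq_of_eqOn {F G : Jet0 n → ℝ} {G' : Jet0 n →L[ℝ] ℝ} (hΩ : IsOpen Ω)
    {x : Jet0 n} (hx : x ∈ Ω) (h : ∀ y ∈ Ω, F y = G y) (hG : HasFDerivAt G G' x) :
    fderiv ℝ F x = G' :=
  (hG.congr_of_eventuallyEq (by filter_upwards [hΩ.mem_nhds hx] with y hy using h y hy)).fderiv

theorem second_fderiv_eq_zero_of_const {F : Jet0 n → ℝ} {G' : Jet0 n →L[ℝ] ℝ} (hΩ : IsOpen Ω)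
    {x : Jet0 n} (hx : x ∈ Ω) (h : ∀ y ∈ Ω, fderiv ℝ F y = G') :
    fderiv ℝ (fderiv ℝ F) x = 0 :=
  ((hasFDerivAt_const G' x).congr_of_eventuallyEq (by
    filter_upwards [hΩ.mem_nhds hx] with y hy using h y hy)).fderiv

/-- For the listed vector fields the prolongation vanishes on the system: the antisymmetric part
rotates `α` and `β` simultaneously, and the Gauss equation is multiplied by `-2 c₀`. -/
theorem determiningEquationsOn_of_constants {X : PointVectorField n} (hΩ : IsOpen Ω)
    (hX : X.IsC2On Ω) {c₀ c₁ c₂ c₃ : ℝ} {a : Matrix (NormalIndex n) (NormalIndex n) ℝ}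
    (ha : ∀ j k, a j k = - a k j)
    (h : ∀ x ∈ Ω, X.ξ x = c₀ * x.1.1 + c₁ ∧ X.η x = c₀ * x.1.2 + c₂ ∧ X.Φ x = c₃ ∧
        (∀ j, X.A j x = ∑ k, a j k * x.2.2.1 k - c₀ * x.2.2.1 j) ∧
        (∀ j, X.B j x = ∑ k, a j k * x.2.2.2 k - c₀ * x.2.2.2 j)) :
    X.DeterminingEquationsOn Ω := by
  have hξ : ∀ y ∈ Ω, fderiv ℝ X.ξ y = c₀ • cu := fun y hy =>
    fderiv_eq_of_eqOn hΩ hy (fun x hx => (h x hx).1)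
      (((cu.hasFDerivAt (x := y)).const_mul c₀).add_const c₁)
  have hη : ∀ y ∈ Ω, fderiv ℝ X.η y = c₀ • cv := fun y hy =>
    fderiv_eq_of_eqOn hΩ hy (fun x hx => (h x hx).2.1)
      (((cv.hasFDerivAt (x := y)).const_mul c₀).add_const c₂)
  have hΦ : ∀ y ∈ Ω, fderiv ℝ X.Φ y = 0 := fun y hy =>
    fderiv_eq_of_eqOn hΩ hy (fun x hx => (h x hx).2.2.1) (hasFDerivAt_const c₃ y)
  have hA : ∀ y ∈ Ω, ∀ j d, fderiv ℝ (X.A j) y d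
      = ∑ k, a j k * d.2.2.1 k - c₀ * d.2.2.1 j := fun y hy j d => by
    rw [fderiv_eq_of_eqOn hΩ hy (fun x hx => (h x hx).2.2.2.1 j)
      ((HasFDerivAt.fun_sum (u := Finset.univ) fun k _ =>
        (hasFDerivAt_α k y).const_mul (a j k)).sub ((hasFDerivAt_α j y).const_mul c₀))]
    simp [-Finset.univ_eq_attach]
  have hB : ∀ y ∈ Ω, ∀ j d, fderiv ℝ (X.B j) y d
      = ∑ k, a j k * d.2.2.2 k - c₀ * d.2.2.2 j := fun y hy j d => by
    rw [fderiv_eq_of_eqOn hΩ hy (fun x hx => (h x hx).2.2.2.2 j)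
      ((HasFDerivAt.fun_sum (u := Finset.univ) fun k _ =>
        (hasFDerivAt_β k y).const_mul (a j k)).sub ((hasFDerivAt_β j y).const_mul c₀))]
    simp [-Finset.univ_eq_attach]
  rintro z hz ⟨h1, h2, h3⟩ -
  have hDuξ : Du X.ξ z = c₀ := by rw [Du_eq, hξ _ hz]; simp
  have hDvξ : Dv X.ξ z = 0 := by rw [Dv_eq, hξ _ hz]; simp
  have hDuη : Du X.η z = 0 := by rw [Du_eq, hη _ hz]; simp
  have hDvη : Dv X.η z = c₀ := by rw [Dv_eq, hη _ hz]; simp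
  have hDuΦ : Du X.Φ z = 0 := by rw [Du_eq, hΦ _ hz]; rfl
  have hDvΦ : Dv X.Φ z = 0 := by rw [Dv_eq, hΦ _ hz]; rfl
  refine ⟨?_, fun j => ?_, fun j => ?_⟩
  · have e1 : Duu X.ξ z = 0 := by
      rw [Duu_eq hΩ hX.1 z hz, second_fderiv_eq_zero_of_const hΩ hz hξ, hξ _ hz]; simp
    have e2 : Duu X.η z = 0 := by
      rw [Duu_eq hΩ hX.2.1 z hz, second_fderiv_eq_zero_of_const hΩ hz hη, hη _ hz]; simp
    have e3 : Duu X.Φ z = 0 := by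
      rw [Duu_eq hΩ hX.2.2.1 z hz, second_fderiv_eq_zero_of_const hΩ hz hΦ, hΦ _ hz]; simp
    have e4 : Dvv X.ξ z = 0 := by
      rw [Dvv_eq hΩ hX.1 z hz, second_fderiv_eq_zero_of_const hΩ hz hξ, hξ _ hz]; simp
    have e5 : Dvv X.η z = 0 := by
      rw [Dvv_eq hΩ hX.2.1 z hz, second_fderiv_eq_zero_of_const hΩ hz hη, hη _ hz]; simp
    have e6 : Dvv X.Φ z = 0 := by
      rw [Dvv_eq hΩ hX.2.2.1 z hz, second_fderiv_eq_zero_of_const hΩ hz hΦ, hΦ _ hz]; simp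
    have eA : ∑ k, X.A k z.jet0 * z.β k
        = ∑ k, ∑ l, a k l * z.α l * z.β k - c₀ * ∑ k, z.α k * z.β k := by
      rw [Finset.mul_sum, ← Finset.sum_sub_distrib]
      refine Finset.sum_congr rfl fun k _ => ?_
      rw [(h _ hz).2.2.2.1 k, ← Finset.sum_mul]
      simp only [Jet2.jet0]
      ring
    have eB : ∑ k, z.α k * X.B k z.jet0
        = -∑ k, ∑ l, a k l * z.α l * z.β k - c₀ * ∑ k, z.α k * z.β k := by
      rw [Finset.sum_comm, Finset.mul_sum, ← Finset.sum_neg_distrib, ← Finset.sum_sub_distrib]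
      refine Finset.sum_congr rfl fun k _ => ?_
      rw [(h _ hz).2.2.2.2 k, mul_sub, Finset.mul_sum, ← Finset.sum_neg_distrib]
      congr 1
      · refine Finset.sum_congr rfl fun l _ => ?_
        rw [ha k l]
        simp only [Jet2.jet0]
        ring
      · simp only [Jet2.jet0]
        ring
    rw [PointVectorField.Φuu, PointVectorField.Φvv, e1, e2, e3, e4, e5, e6, hDuξ, hDvξ, hDuη,
      hDvη, eA, eB]
    linear_combination (-2 * c₀) * h1
  · rw [PointVectorField.Av, PointVectorField.Φv, hDvξ, hDvη, hDvΦ, Dv_eq, hA _ hz,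
      (h _ hz).2.2.2.2 j]
    have e : ∑ k, a j k * z.α_v k = z.θ_v * ∑ k, a j k * z.β k := by
      rw [Finset.mul_sum]
      exact Finset.sum_congr rfl fun k _ => by rw [h2]; ring
    simp only [Jet2.jet0, e]
    rw [h2]
    ring
  · rw [PointVectorField.Bu, PointVectorField.Φu, hDuξ, hDuη, hDuΦ, Du_eq, hB _ hz,
      (h _ hz).2.2.2.1 j]
    have e : ∑ k, a j k * z.β_u k = z.θ_u * ∑ k, a j k * z.α k := by
      rw [Finset.mul_sum]
      exact Finset.sum_congr rfl fun k _ => by rw [h3]; ring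
    simp only [Jet2.jet0, e]
    rw [h3]
    ring

end Converse

end Isothermic

theorem theorem2 (n : ℕ) (hn : 3 ≤ n) (Ω : Set (Isothermic.Jet0 n)) (hΩ : IsOpen Ω)
    (hΩc : IsConnected Ω) (X : Isothermic.PointVectorField n) (hX : X.IsC2On Ω) :
    X.DeterminingEquationsOn Ω ↔
      ∃ (c₀ c₁ c₂ c₃ : ℝ) (a : Matrix (Isothermic.NormalIndex n) (Isothermic.NormalIndex n) ℝ),
        (∀ j k, a j k = - a k j) ∧
        ∀ (u v θ : ℝ) (α β : Isothermic.NormalIndex n → ℝ), ((u, v), θ, α, β) ∈ Ω →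
          X.ξ ((u, v), θ, α, β) = c₀ * u + c₁ ∧
          X.η ((u, v), θ, α, β) = c₀ * v + c₂ ∧
          X.Φ ((u, v), θ, α, β) = c₃ ∧
          (∀ j, X.A j ((u, v), θ, α, β) = ∑ k, a j k * α k - c₀ * α j) ∧
          (∀ j, X.B j ((u, v), θ, α, β) = ∑ k, a j k * β k - c₀ * β j) := by
  constructor
  · intro hD
    obtain ⟨c₀, c₁, c₂, c₃, a, ha, h⟩ := Isothermic.exists_constants hn hΩ hΩc hX hD
    exact ⟨c₀, c₁, c₂, c₃, a, ha, fun u v θ α β hx => h _ hx⟩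
  · rintro ⟨c₀, c₁, c₂, c₃, a, ha, h⟩
    exact Isothermic.determiningEquationsOn_of_constants hΩ hX ha
      fun ⟨⟨u, v⟩, θ, α, β⟩ hx => h u v θ α β hx
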